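/- Let $A$ be a commutative affine (that is, finitely generated) $\mathbb{C}$-algebra and let $\delta : A \to A$ be a non-zero $\mathbb{C}$-linear derivation. Let $\{-,-\}_\delta$ be the Poisson bracket on the polynomial algebra $A[z]$ determined by $\{a,b\}_\delta = 0$ and $\{z,a\}_\delta = \delta(a)$ for all $a, b \in A$; explicitly, $$\{a z^m, b z^n\}_\delta = (m\,a\,\delta(b) - n\,b\,\delta(a))\,z^{m+n-1} \qquad (a,b\in A,\ m,n\ge 0).$$ Let $A[z;\delta]$ be the Ore extension, that is, the ring whose elements are the polynomials $\sum_i a_i z^i$ with $a_i \in A$, with the multiplication determined by that of $A$ and by $za - az = \delta(a)$ for all $a \in A$. A Poisson ideal of a commutative Poisson algebra $B$ is an ideal $I$ with $\{b,i\} \in I$ for all $b \in B$, $i \in I$. The algebra $B$ is called Poisson primitive if $0$ is a Poisson primitive ideal, that is, if $B$ has a maximal ideal $M$ such that the largest Poisson ideal of $B$ contained in $M$ is $0$. Then the Poisson algebra $A[z]$, with the bracket $\{-,-\}_\delta$, is Poisson primitive if and only if the ring $A[z;\delta]$ is primitive. This holds for both readings of "primitive": left primitive (there is a faithful simple left module)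 and right primitive (there is a faithful simple right module). -/

import Mathlib

open Polynomial

universe u

noncomputable section

/-! ## Ideals stable under a set of derivations -/

/-- `I` is a `Δ`-ideal: it is stable under all derivations in `Δ`. -/
def IsDeltaIdeal {A : Type u} [CommRing A] [Algebra ℂ A]
    (Δ : Set (Derivation ℂ A A)) (I : Ideal A) : Prop :=
  ∀ d ∈ Δ, ∀ a ∈ I, d a ∈ I

/-- The `Δ`-core `(I : Δ)` of an ideal: the supremum of the `Δ`-ideals contained in `I`. -/
def deltaCore {A : Type u} [CommRing A] [Algebra ℂ A]
    (Δ : Set (Derivation ℂ A A)) (I : Ideal A) : Ideal A :=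
  sSup {J : Ideal A | IsDeltaIdeal Δ J ∧ J ≤ I}

/-- The `Δ`-core of `I` is the largest `Δ`-ideal contained in `I`. -/
theorem isGreatest_deltaCore {A : Type u} [CommRing A] [Algebra ℂ A]
    (Δ : Set (Derivation ℂ A A)) (I : Ideal A) :
    IsGreatest {J : Ideal A | IsDeltaIdeal Δ J ∧ J ≤ I} (deltaCore Δ I) := by
  refine ⟨⟨?_, sSup_le fun J hJ => hJ.2⟩, fun J hJ => le_sSup hJ⟩
  intro d hd a ha
  unfold deltaCore at ha
  rw [sSup_eq_iSup'] at ha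
  refine Submodule.iSup_induction _ (motive := fun x => d x ∈ deltaCore Δ I) ha ?_ ?_ ?_
  · intro J x hx
    exact (le_sSup J.2 : J.1 ≤ deltaCore Δ I) (J.2.1 d hd x hx)
  · simp
  · intro x y hx hy
    rw [map_add]
    exact add_mem hx hy

/-- `P` is a `Δ`-primitive ideal: a `Δ`-ideal that is the `Δ`-core of a maximal ideal. -/
def IsDeltaPrimitive {A : Type u} [CommRing A] [Algebra ℂ A]
    (Δ : Set (Derivation ℂ A A)) (P : Ideal A) : Prop :=
  IsDeltaIdeal Δ P ∧ ∃ M : Ideal A, M.IsMaximal ∧ P = deltaCore Δ M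

/-! ## Poisson algebras -/

/-- A Poisson bracket on a commutative `ℂ`-algebra: a `ℂ`-bilinear Lie bracket each of whose
hamiltonians `{a, -}` is a derivation. -/
structure PoissonBracket (B : Type u) [CommRing B] [Algebra ℂ B] where
  bracket : B →ₗ[ℂ] B →ₗ[ℂ] B
  alternating : ∀ a, bracket a a = 0
  jacobi : ∀ a b c,
    bracket a (bracket b c) + bracket b (bracket c a) + bracket c (bracket a b) = 0
  leibniz : ∀ a b c, bracket a (b * c) = b * bracket a c + c * bracket a b

namespace PoissonBracket

variable {B : Type u} [CommRing B] [Algebra ℂ B]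

/-- The hamiltonian `{a, -}`. -/
def ham (π : PoissonBracket B) (a : B) : Derivation ℂ B B :=
  Derivation.mk' (π.bracket a) (fun b c => by simpa using π.leibniz a b c)

/-- Poisson primitive ideals: `Δ`-primitive ideals, for `Δ` the set of all hamiltonians. -/
def IsPrimitiveIdeal (π : PoissonBracket B) (P : Ideal B) : Prop :=
  IsDeltaPrimitive (Set.range π.ham) P

/-- The Poisson algebra `(B, π)` is Poisson primitive: `0` is a Poisson primitive ideal. -/
def IsPoissonPrimitive (π : PoissonBracket B) : Prop :=
  π.IsPrimitiveIdeal ⊥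

end PoissonBracket

/-! ## The bracket `{-,-}_δ` on `A[z]` -/

section Delta

variable {A : Type u} [CommRing A] [Algebra ℂ A]

/-- The extension of `δ` to `A[z]`, acting on coefficients: `∑ aᵢ zⁱ ↦ ∑ δ(aᵢ) zⁱ`. -/
def coeffDerivation (δ : Derivation ℂ A A) : Derivation ℂ A[X] A[X] :=
  PolynomialModule.equivPolynomialSelf.compDer δ.mapCoeffs

@[simp] theorem coeffDerivation_monomial (δ : Derivation ℂ A A) (n : ℕ) (a : A) :
    coeffDerivation δ (monomial n a) = monomial n (δ a) := by
  simp [coeffDerivation, PolynomialModule.equivPolynomialSelf]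

@[simp] theorem coeffDerivation_C (δ : Derivation ℂ A A) (a : A) :
    coeffDerivation δ (C a) = C (δ a) := coeffDerivation_monomial δ 0 a

@[simp] theorem coeffDerivation_X (δ : Derivation ℂ A A) :
    coeffDerivation δ (X : A[X]) = 0 := by
  rw [← monomial_one_one_eq_X, coeffDerivation_monomial]; simp

theorem derivative_coeffDerivation (δ : Derivation ℂ A A) (f : A[X]) :
    derivative (coeffDerivation δ f) = coeffDerivation δ (derivative f) := by
  induction f using Polynomial.induction_on' with
  | add p q hp hq => simp [hp, hq]
  | monomial n a => simp [derivative_monomial, mul_comm]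

/-- The bracket `{f, g}_δ = (∂f/∂z) δ(g) - (∂g/∂z) δ(f)` on `A[z]`. -/
def deltaBracket (δ : Derivation ℂ A A) : PoissonBracket A[X] where
  bracket := LinearMap.mk₂ ℂ
    (fun f g => derivative f * coeffDerivation δ g - derivative g * coeffDerivation δ f)
    (by intros; simp only [map_add]; ring)
    (by intros; simp only [Derivation.map_smul, derivative_smul, smul_sub, smul_mul_assoc,
      mul_smul_comm])
    (by intros; simp only [map_add]; ring)
    (by intros; simp only [Derivation.map_smul, derivative_smul, smul_sub, smul_mul_assoc,
      mul_smul_comm])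
  alternating := fun f => by simp
  jacobi := fun f g h => by
    simp only [LinearMap.mk₂_apply, map_sub, Derivation.leibniz, derivative_mul,
      derivative_coeffDerivation, smul_eq_mul]
    ring
  leibniz := fun f g h => by
    simp only [LinearMap.mk₂_apply, Derivation.leibniz, derivative_mul, smul_eq_mul]
    ring

/-- `{a, b}_δ = 0` for `a, b ∈ A`. -/
theorem deltaBracket_C_C (δ : Derivation ℂ A A) (a b : A) :
    (deltaBracket δ).bracket (C a) (C b) = 0 := by
  simp [deltaBracket]

/-- `{z, a}_δ = δ(a)` for `a ∈ A`. -/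
theorem deltaBracket_X_C (δ : Derivation ℂ A A) (a : A) :
    (deltaBracket δ).bracket X (C a) = C (δ a) := by
  simp [deltaBracket]

/-! ## The Ore extension `A[z; δ]` -/

/-- The Ore extension `A[z; δ]`: as an additive group it is `A[z]`, that is, its elements are the
`∑ aᵢ zⁱ`; its product is the one determined by `z a = a z + δ(a)`. -/
def OreExtension (_δ : Derivation ℂ A A) : Type u := A[X]

namespace OreExtension

instance (δ : Derivation ℂ A A) : AddCommGroup (OreExtension δ) :=
  inferInstanceAs (AddCommGroup A[X])

/-- Left multiplication by `z` on `A[z; δ]`: `∑ bᵢ zⁱ ↦ ∑ (bᵢ zⁱ⁺¹ + δ(bᵢ) zⁱ)`. -/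
def mulZ (δ : Derivation ℂ A A) : Module.End ℂ A[X] :=
  LinearMap.mulLeft ℂ X + (coeffDerivation δ : A[X] →ₗ[ℂ] A[X])

/-- Left multiplication by `∑ aᵢ zⁱ` on `A[z; δ]`: it is `∑ aᵢ • (mulZ δ) ^ i`. -/
def mulOp (δ : Derivation ℂ A A) : A[X] →+ Module.End ℂ A[X] where
  toFun f := f.sum fun i a => a • mulZ δ ^ i
  map_zero' := by simp
  map_add' f g := Polynomial.sum_add_index f g _ (by simp) (by intros; simp [add_smul])

theorem mulOp_monomial (δ : Derivation ℂ A A) (n : ℕ) (a : A) :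
    mulOp δ (monomial n a) = a • mulZ δ ^ n :=
  Polynomial.sum_monomial_index (f := fun i (b : A) => b • mulZ δ ^ i) a (zero_smul _ _)

theorem mulZ_smul (δ : Derivation ℂ A A) (a : A) (f : A[X]) :
    mulZ δ (a • f) = a • mulZ δ f + δ a • f := by
  simp only [mulZ, LinearMap.add_apply, LinearMap.mulLeft_apply, Derivation.coeFn_coe,
    smul_eq_C_mul, Derivation.leibniz, coeffDerivation_C, smul_eq_mul]
  ring

theorem mulZ_monomial (δ : Derivation ℂ A A) (n : ℕ) (a : A) :
    mulZ δ (monomial n a) = monomial (n + 1) a + monomial n (δ a) := by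
  simp [mulZ, X_mul_monomial]

theorem mulOp_smul (δ : Derivation ℂ A A) (a : A) (f : A[X]) :
    mulOp δ (a • f) = a • mulOp δ f := by
  induction f using Polynomial.induction_on' with
  | add p q hp hq => simp [hp, hq, smul_add]
  | monomial n b => simp [smul_monomial, mulOp_monomial, mul_smul]

theorem mulOp_mulZ (δ : Derivation ℂ A A) (f : A[X]) :
    mulOp δ (mulZ δ f) = mulZ δ * mulOp δ f := by
  induction f using Polynomial.induction_on' with
  | add p q hp hq => simp only [map_add, hp, hq, mul_add]
  | monomial n b =>
    ext1 g
    simp [mulZ_monomial, mulOp_monomial, mulZ_smul, pow_succ']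

theorem mulOp_mulZ_pow (δ : Derivation ℂ A A) (n : ℕ) (f : A[X]) :
    mulOp δ ((mulZ δ ^ n) f) = mulZ δ ^ n * mulOp δ f := by
  induction n with
  | zero => simp
  | succ n ih => rw [pow_succ', Module.End.mul_apply, mulOp_mulZ, ih, mul_assoc]

theorem mulOp_mulOp (δ : Derivation ℂ A A) (f g : A[X]) :
    mulOp δ (mulOp δ f g) = mulOp δ f * mulOp δ g := by
  induction f using Polynomial.induction_on' with
  | add p q hp hq => simp only [map_add, LinearMap.add_apply, hp, hq, add_mul]
  | monomial n b =>
    rw [mulOp_monomial, LinearMap.smul_apply, mulOp_smul, mulOp_mulZ_pow]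
    ext1 h
    simp

theorem mulZ_pow_one (δ : Derivation ℂ A A) (n : ℕ) :
    (mulZ δ ^ n) 1 = monomial n 1 := by
  induction n with
  | zero => simp
  | succ n ih => rw [pow_succ', Module.End.mul_apply, ih, mulZ_monomial]; simp

theorem mulOp_apply_one (δ : Derivation ℂ A A) (f : A[X]) : mulOp δ f 1 = f := by
  induction f using Polynomial.induction_on' with
  | add p q hp hq => simp only [map_add, LinearMap.add_apply, hp, hq]
  | monomial n b => simp [mulOp_monomial, mulZ_pow_one, smul_monomial]

theorem mulOp_one (δ : Derivation ℂ A A) : mulOp δ 1 = 1 := by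
  rw [← monomial_zero_one, mulOp_monomial]; simp

instance (δ : Derivation ℂ A A) : Ring (OreExtension δ) :=
  { (inferInstance : AddCommGroup (OreExtension δ)) with
    mul := fun f g => mulOp δ f g
    one := (1 : A[X])
    left_distrib := fun f g h => map_add (mulOp δ f) g h
    right_distrib := fun f g h =>
      (congrArg (fun T : Module.End ℂ A[X] => T h) (map_add (mulOp δ) f g))
    zero_mul := fun f => (congrArg (fun T : Module.End ℂ A[X] => T f) (map_zero (mulOp δ)))
    mul_zero := fun f => map_zero (mulOp δ f)
    mul_assoc := fun f g h =>
      (congrArg (fun T : Module.End ℂ A[X] => T h) (mulOp_mulOp δ f g))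
    one_mul := fun f => (congrArg (fun T : Module.End ℂ A[X] => T f) (mulOp_one δ))
    mul_one := fun f => mulOp_apply_one δ f }

/-- The element `a zⁿ` of `A[z; δ]`. -/
def mono (δ : Derivation ℂ A A) (n : ℕ) (a : A) : OreExtension δ := (monomial n a : A[X])

/-- The inclusion of `A` in `A[z; δ]` is multiplicative. -/
theorem mono_zero_mul (δ : Derivation ℂ A A) (a b : A) :
    mono δ 0 a * mono δ 0 b = mono δ 0 (a * b) := by
  change mulOp δ (monomial 0 a) (monomial 0 b) = monomial 0 (a * b)
  rw [mulOp_monomial, pow_zero, LinearMap.smul_apply, Module.End.one_apply, smul_monomial,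
    smul_eq_mul]

/-- `a · zⁿ` is the element `a zⁿ`, and the powers of `z` are as expected. -/
theorem mono_eq (δ : Derivation ℂ A A) (n : ℕ) (a : A) :
    mono δ n a = mono δ 0 a * mono δ 1 1 ^ n := by
  have h : ∀ n, mono δ 1 1 ^ n = mono δ n 1 := by
    intro n
    induction n with
    | zero => rfl
    | succ n ih =>
      rw [pow_succ', ih]
      change mulOp δ (monomial 1 1) (monomial n 1) = monomial (n + 1) 1
      simp [mulOp_monomial, mulZ_monomial]
  rw [h]
  change monomial n a = mulOp δ (monomial 0 a) (monomial n 1)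
  rw [mulOp_monomial, pow_zero, LinearMap.smul_apply, Module.End.one_apply, smul_monomial,
    smul_eq_mul, mul_one]

/-- The defining relation `z a - a z = δ(a)`. -/
theorem z_mul_sub (δ : Derivation ℂ A A) (a : A) :
    mono δ 1 1 * mono δ 0 a - mono δ 0 a * mono δ 1 1 = mono δ 0 (δ a) := by
  change mulOp δ (monomial 1 1) (monomial 0 a) - mulOp δ (monomial 0 a) (monomial 1 1)
    = (monomial 0 (δ a) : A[X])
  simp only [mulOp_monomial, LinearMap.smul_apply, pow_one, pow_zero, one_smul, mulZ_monomial,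
    Module.End.one_apply, smul_monomial, smul_eq_mul, mul_one, zero_add]
  exact add_sub_cancel_left _ _

end OreExtension

end Delta

/-! ## Primitive rings -/

/-- A ring is left primitive if it has a faithful simple left module. (A simple module is
isomorphic to a quotient of `R`, so modules in the universe of `R` suffice.) -/
def IsLeftPrimitiveRing (R : Type u) [Ring R] : Prop :=
  ∃ (M : Type u) (_ : AddCommGroup M) (_ : Module R M), IsSimpleModule R M ∧ FaithfulSMul R M

/-- A ring is right primitive if it has a faithful simple right module. -/
def IsRightPrimitiveRing (R : Type u) [Ring R] : Prop :=
  IsLeftPrimitiveRing Rᵐᵒᵖ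

end

/-! All three properties are equivalent to `IsDerivationPrimitive δ`: some maximal ideal of `A`
contains no non-zero `δ`-ideal. A prime with this property forces `A` to be a domain, because in
characteristic zero the largest `d`-ideal inside a prime is prime (`isPrime_iterateCore`).

In a domain, bracketing with an element of `A`, or taking commutators with it, lowers the degree in
`z` without giving zero. So every non-zero Poisson ideal of `A[z]` and every non-zero two-sided
ideal of `A[z; δ]` meets `A` in a non-zero ideal, and this ideal is a `δ`-ideal. Hence a maximal
ideal `M` with trivial core yields a maximal ideal of `A[z]` with trivial Poisson core, and any
maximal one-sided ideal above `M` yields a faithful simple module. For the Poisson converse, maximal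
ideals of `A[z]` contract to maximal ideals of `A`.

The hard direction is `IsDifferential.isDerivationPrimitive`. Let `N` be a faithful simple module
and `Q` the annihilator in `A` of some `x`, chosen prime. Since the iterates of `z` on `x` span `N`,
the core of `Q` is trivial. If `Q ≠ 0`, then `Q` is not `δ`-stable, and a leading-term argument
shows that `Q` is maximal. If `Q = 0`, a relation of least degree killing `x` has a leading
coefficient `c` lying in every non-zero prime `δ`-ideal; a maximal ideal avoiding `c` then has
trivial core.

The opposite ring of `A[z; δ]` satisfies the same relations with `-δ`, which has the same stable
ideals. -/

noncomputable section

section DerivationPrimitive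

variable {A : Type u} [CommRing A] [Algebra ℂ A]

/-! ## Ideals with trivial core -/

/-- The only `d`-ideal contained in `Q` is `0`. -/
def HasTrivialCore (d : Derivation ℂ A A) (Q : Ideal A) : Prop :=
  ∀ J : Ideal A, (∀ a ∈ J, d a ∈ J) → J ≤ Q → J = ⊥

/-- Some maximal ideal of `A` contains no non-zero `d`-ideal. -/
def IsDerivationPrimitive (d : Derivation ℂ A A) : Prop :=
  ∃ M : Ideal A, M.IsMaximal ∧ HasTrivialCore d M

theorem HasTrivialCore.neg {d : Derivation ℂ A A} {Q : Ideal A} (h : HasTrivialCore d Q) :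
    HasTrivialCore (-d) Q :=
  fun J hJ hJQ => h J (fun a ha => by simpa using hJ a ha) hJQ

theorem isDerivationPrimitive_neg {d : Derivation ℂ A A} :
    IsDerivationPrimitive (-d) ↔ IsDerivationPrimitive d :=
  ⟨fun ⟨M, hM, h⟩ => ⟨M, hM, by simpa using h.neg⟩, fun ⟨M, hM, h⟩ => ⟨M, hM, h.neg⟩⟩

theorem isDeltaPrimitive_bot_iff (Δ : Set (Derivation ℂ A A)) :
    IsDeltaPrimitive Δ (⊥ : Ideal A) ↔
      ∃ M : Ideal A, M.IsMaximal ∧ ∀ J : Ideal A, IsDeltaIdeal Δ J → J ≤ M → J = ⊥ := by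
  constructor
  · rintro ⟨-, M, hM, h⟩
    exact ⟨M, hM, fun J hJ hJM =>
      le_bot_iff.1 (((isGreatest_deltaCore Δ M).2 ⟨hJ, hJM⟩).trans h.ge)⟩
  · rintro ⟨M, hM, h⟩
    refine ⟨fun d _ a ha => ?_, M, hM, ?_⟩
    · rw [Ideal.mem_bot] at ha ⊢
      rw [ha, map_zero]
    · have hc := (isGreatest_deltaCore Δ M).1
      exact (h _ hc.1 hc.2).symm

/-- The elements all of whose iterated derivatives lie in `Q`. -/
def iterateCore (d : Derivation ℂ A A) (Q : Ideal A) : Ideal A where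
  carrier := {a | ∀ n, d^[n] a ∈ Q}
  add_mem' ha hb n := by
    rw [iterate_map_add]
    exact add_mem (ha n) (hb n)
  zero_mem' n := by
    rw [iterate_map_zero]
    exact zero_mem Q
  smul_mem' b a ha n := by
    change d^[n] (b * a) ∈ Q
    induction n generalizing a b with
    | zero => exact Q.mul_mem_left b (ha 0)
    | succ n ih =>
      rw [Function.iterate_succ_apply, Derivation.leibniz, iterate_map_add, smul_eq_mul,
        smul_eq_mul, mul_comm a]
      exact add_mem (ih b (d a) fun k => ha (k + 1)) (ih (d b) a ha)

theorem mem_iterateCore {d : Derivation ℂ A A} {Q : Ideal A} {a : A} :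
    a ∈ iterateCore d Q ↔ ∀ n, d^[n] a ∈ Q := Iff.rfl

theorem iterateCore_le (d : Derivation ℂ A A) (Q : Ideal A) : iterateCore d Q ≤ Q :=
  fun _ ha => ha 0

theorem derivation_mem_iterateCore {d : Derivation ℂ A A} {Q : Ideal A} {a : A}
    (ha : a ∈ iterateCore d Q) : d a ∈ iterateCore d Q :=
  fun n => ha (n + 1)

theorem HasTrivialCore.iterateCore_eq_bot {d : Derivation ℂ A A} {Q : Ideal A}
    (h : HasTrivialCore d Q) : iterateCore d Q = ⊥ :=
  h _ (fun _ => derivation_mem_iterateCore) (iterateCore_le d Q)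

/-- By the Leibniz rule every term is a multiple of `d^[i] a * d^[j] b` with `i + j = k < m + n`, so
`i < m` or `j < n`. -/
theorem iterate_mul_mem (d : Derivation ℂ A A) (Q : Ideal A) (k : ℕ) :
    ∀ (m n : ℕ) (a b : A), k < m + n → (∀ i < m, d^[i] a ∈ Q) → (∀ j < n, d^[j] b ∈ Q) →
      d^[k] (a * b) ∈ Q := by
  induction k with
  | zero =>
    intro m n a b hk ha hb
    rcases Nat.eq_zero_or_pos m with rfl | hm
    · exact Q.mul_mem_left a (hb 0 (by omega))
    · exact Q.mul_mem_right b (ha 0 hm)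
  | succ k ih =>
    intro m n a b hk ha hb
    rw [Function.iterate_succ_apply, Derivation.leibniz, iterate_map_add, smul_eq_mul,
      smul_eq_mul, mul_comm b]
    exact add_mem
      (ih m (n - 1) a (d b) (by omega) ha fun j hj => hb (j + 1) (by omega))
      (ih (m - 1) n (d a) b (by omega) (fun i hi => ha (i + 1) (by omega)) hb)

/-- In total order `m + n` only the Leibniz term of bidegree `(m, n)` can escape `Q`. -/
theorem iterate_mul_sub_mem (d : Derivation ℂ A A) (Q : Ideal A) (m n : ℕ) :
    ∀ a b : A, (∀ i < m, d^[i] a ∈ Q) → (∀ j < n, d^[j] b ∈ Q) →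
      d^[m + n] (a * b) - ((m + n).choose m : A) * (d^[m] a * d^[n] b) ∈ Q := by
  induction hk : m + n generalizing m n with
  | zero =>
    obtain ⟨rfl, rfl⟩ : m = 0 ∧ n = 0 := by omega
    simp
  | succ k ih =>
    intro a b ha hb
    rw [Function.iterate_succ_apply, Derivation.leibniz, iterate_map_add, smul_eq_mul,
      smul_eq_mul, mul_comm b]
    -- If `m` or `n` vanishes, one of the two summands is already in `Q`; otherwise the two
    -- coefficients add up by Pascal's rule.
    rcases m with - | m <;> rcases n with - | n
    · omega
    · have h1 := ih 0 n (by omega) a (d b) (by simp) fun j hj => hb (j + 1) (by omega)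
      have h2 := iterate_mul_mem d Q k 0 (n + 1) (d a) b (by omega) (by simp) hb
      convert add_mem h1 h2 using 1
      simp only [Nat.choose_zero_right, Function.iterate_succ_apply]
      ring
    · have h1 := ih m 0 (by omega) (d a) b (fun j hj => ha (j + 1) (by omega)) (by simp)
      have h2 := iterate_mul_mem d Q k (m + 1) 0 a (d b) (by omega) ha (by simp)
      obtain rfl : m = k := by omega
      convert add_mem h1 h2 using 1
      simp only [Nat.choose_self, Function.iterate_succ_apply]
      ring
    · have h1 := ih (m + 1) n (by omega) a (d b) ha fun j hj => hb (j + 1) (by omega)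
      have h2 := ih m (n + 1) (by omega) (d a) b (fun j hj => ha (j + 1) (by omega)) hb
      convert add_mem h1 h2 using 1
      simp only [Nat.choose_succ_succ, Function.iterate_succ_apply, Nat.cast_add]
      ring

theorem isUnit_natCast_of_ne_zero {n : ℕ} (hn : n ≠ 0) : IsUnit (n : A) := by
  have h : IsUnit (algebraMap ℂ A n) :=
    (isUnit_iff_ne_zero.2 (Nat.cast_ne_zero.2 hn)).map (algebraMap ℂ A)
  simpa using h

theorem natCast_mul_mem_iff {Q : Ideal A} {n : ℕ} (hn : n ≠ 0) {a : A} :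
    (n : A) * a ∈ Q ↔ a ∈ Q :=
  Ideal.unit_mul_mem_iff_mem Q (isUnit_natCast_of_ne_zero hn)

/-- Let `m` and `n` be the first orders at which the derivatives of `a` and `b` leave `Q`. Then
`d^[m + n] (a * b)` is, modulo `Q`, a binomial coefficient times a product outside `Q`, and that
coefficient is a unit. -/
theorem isPrime_iterateCore (d : Derivation ℂ A A) (Q : Ideal A) [hQ : Q.IsPrime] :
    (iterateCore d Q).IsPrime := by
  classical
  refine ⟨fun h => hQ.ne_top (top_le_iff.1 (h.ge.trans (iterateCore_le d Q))), ?_⟩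
  intro a b hab
  by_contra! hcon
  obtain ⟨ha, hb⟩ := hcon
  simp only [mem_iterateCore, not_forall] at ha hb
  have key := iterate_mul_sub_mem d Q (Nat.find ha) (Nat.find hb) a b
    (fun i hi => not_not.1 (Nat.find_min ha hi)) (fun i hi => not_not.1 (Nat.find_min hb hi))
  rw [Submodule.sub_mem_iff_right _ (hab _), natCast_mul_mem_iff
    (Nat.choose_pos (Nat.le_add_right _ _)).ne'] at key
  exact (hQ.mem_or_mem key).elim (Nat.find_spec ha) (Nat.find_spec hb)

theorem HasTrivialCore.isDomain {d : Derivation ℂ A A} {Q : Ideal A} [Q.IsPrime]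
    (h : HasTrivialCore d Q) : IsDomain A := by
  have h1 := isPrime_iterateCore d Q
  rw [h.iterateCore_eq_bot] at h1
  exact IsDomain.of_bot_isPrime A

/-! ## Poisson primitivity of `A[z]` -/

theorem coeff_coeffDerivation (δ : Derivation ℂ A A) (f : A[X]) (n : ℕ) :
    (coeffDerivation δ f).coeff n = δ (f.coeff n) := by
  induction f using Polynomial.induction_on' with
  | add p q hp hq => simp [hp, hq]
  | monomial m a =>
    rw [coeffDerivation_monomial, coeff_monomial, coeff_monomial]
    split_ifs <;> simp

theorem ham_deltaBracket_apply (δ : Derivation ℂ A A) (f g : A[X]) :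
    (deltaBracket δ).ham f g =
      derivative f * coeffDerivation δ g - derivative g * coeffDerivation δ f := rfl

/-- The hamiltonian of `C b` sends `g` to `-g' δ(b)`. With `δ b ≠ 0` this is non-zero of smaller
degree as long as `g` is not constant. -/
theorem exists_C_mem_of_isDeltaIdeal [IsDomain A] {δ : Derivation ℂ A A} (hδ : δ ≠ 0)
    {J : Ideal A[X]} (hJ : IsDeltaIdeal (Set.range (deltaBracket δ).ham) J) (hJ0 : J ≠ ⊥) :
    ∃ a ≠ 0, C a ∈ J := by
  have : CharZero A := charZero_of_injective_algebraMap (algebraMap ℂ A).injective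
  obtain ⟨b, hb⟩ : ∃ b, δ b ≠ 0 := by
    by_contra! h
    exact hδ (Derivation.ext h)
  obtain ⟨g, hg, hg0⟩ := Submodule.exists_mem_ne_zero_of_ne_bot hJ0
  induction hn : g.natDegree using Nat.strong_induction_on generalizing g with
  | _ n ih =>
    by_cases h0 : n = 0
    · rw [h0] at hn
      rw [eq_C_of_natDegree_eq_zero hn] at hg hg0
      exact ⟨_, fun h => hg0 (by rw [h, C_0]), hg⟩
    · have hd : derivative g ≠ 0 := fun h => h0 (hn ▸ derivative_eq_zero.1 h)
      have hC : (C (δ b) : A[X]) ≠ 0 := by simpa using hb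
      have hmem : derivative g * C (δ b) ∈ J := by
        have h := hJ _ ⟨C b, rfl⟩ g hg
        rw [ham_deltaBracket_apply] at h
        simpa using h
      refine ih _ ?_ _ hmem (mul_ne_zero hd hC) rfl
      rw [natDegree_mul hd hC, natDegree_C, add_zero, ← hn]
      exact natDegree_derivative_lt (hn ▸ h0)

theorem isPoissonPrimitive_deltaBracket_iff [Algebra.FiniteType ℂ A] {δ : Derivation ℂ A A}
    (hδ : δ ≠ 0) : (deltaBracket δ).IsPoissonPrimitive ↔ IsDerivationPrimitive δ := by
  have : IsJacobsonRing A := isJacobsonRing_of_finiteType (A := ℂ)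
  unfold PoissonBracket.IsPoissonPrimitive PoissonBracket.IsPrimitiveIdeal
  rw [isDeltaPrimitive_bot_iff]
  constructor
  · rintro ⟨M, hM, h⟩
    -- The Nullstellensatz enters here: `A` is a Jacobson ring. A `δ`-ideal of `A` extends to a
    -- Poisson ideal of `A[z]`.
    refine ⟨M.comap C, isMaximal_comap_C_of_isJacobsonRing M, fun J hJ hJM => ?_⟩
    have h1 : J.map C = ⊥ := by
      refine h _ ?_ (Ideal.map_le_iff_le_comap.2 hJM)
      rintro _ ⟨f, rfl⟩ g hg
      rw [ham_deltaBracket_apply]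
      rw [Ideal.mem_map_C_iff] at hg
      refine sub_mem (Ideal.mul_mem_left _ _ ?_) (Ideal.mul_mem_right _ _ ?_)
      · rw [Ideal.mem_map_C_iff]
        intro n
        rw [coeff_coeffDerivation]
        exact hJ _ (hg n)
      · rw [Ideal.mem_map_C_iff]
        intro n
        rw [coeff_derivative]
        exact J.mul_mem_right _ (hg _)
    exact (Ideal.map_eq_bot_iff_of_injective C_injective).1 h1
  · rintro ⟨M, hM, h⟩
    have : IsDomain A := h.isDomain
    -- The maximal ideal generated by `M` and `z`. The contraction of a Poisson ideal to `A` is a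
    -- `δ`-ideal because `{z, b} = δ(b)`.
    refine ⟨M.comap (evalRingHom 0), Ideal.comap_isMaximal_of_surjective _
      fun a => ⟨C a, by simp⟩, fun J hJ hJM => ?_⟩
    by_contra hJ0
    obtain ⟨a, ha0, ha⟩ := exists_C_mem_of_isDeltaIdeal hδ hJ hJ0
    have h1 := h (J.comap C) (fun b hb => ?_) (fun b hb => by simpa using hJM hb)
    · have : a ∈ J.comap C := ha
      rw [h1] at this
      exact ha0 this
    · have := hJ _ ⟨X, rfl⟩ _ (Ideal.mem_comap.1 hb)
      rw [ham_deltaBracket_apply] at this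
      simpa using this

end DerivationPrimitive

/-! ## Simple modules over differential rings -/

/-- The action on `N` of an element of degree one over `A` with commutator `d`. -/
def IsDifferential {A : Type*} {N : Type*} [CommRing A] [Algebra ℂ A] [AddCommGroup N] [Module A N]
    (d : Derivation ℂ A A) (D : N →+ N) : Prop :=
  ∀ (a : A) (n : N), D (a • n) = a • D n + d a • n

/-- There is no proper non-zero `A`-submodule stable under `D`. -/
def IsDifferentiallySimple (A : Type*) {N : Type*} [CommRing A] [AddCommGroup N] [Module A N]
    (D : N →+ N) : Prop :=
  ∀ S : Submodule A N, (∀ n ∈ S, D n ∈ S) → S ≠ ⊥ → S = ⊤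

namespace IsDifferential

/-! ### The filtration of a module by order in `D` -/

section Filtration

variable {A : Type*} {N : Type*} [CommRing A] [AddCommGroup N] [Module A N] {D : N →+ N}

variable (A D) in
/-- The `A`-submodule generated by the `Dⁱ x` with `i < k`. -/
def filtration (x : N) (k : ℕ) : Submodule A N :=
  Submodule.span A ((fun i => D^[i] x) '' Set.Iio k)

theorem iterate_mem_filtration {x : N} {i k : ℕ} (h : i < k) :
    D^[i] x ∈ filtration A D x k :=
  Submodule.subset_span ⟨i, h, rfl⟩

theorem filtration_le {x : N} {k : ℕ} {S : Submodule A N} (h : ∀ i < k, D^[i] x ∈ S) :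
    filtration A D x k ≤ S := by
  refine Submodule.span_le.2 ?_
  rintro _ ⟨i, hi, rfl⟩
  exact h i hi

theorem filtration_mono (x : N) : Monotone (filtration A D x) :=
  fun _ _ h => filtration_le fun _ hi => iterate_mem_filtration (hi.trans_le h)

theorem filtration_zero (x : N) : filtration A D x 0 = ⊥ :=
  le_bot_iff.1 (filtration_le (by simp))

theorem filtration_succ (x : N) (k : ℕ) :
    filtration A D x (k + 1) = filtration A D x k ⊔ Submodule.span A {D^[k] x} := by
  refine le_antisymm (filtration_le fun i hi => ?_) (sup_le (filtration_mono x k.le_succ)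
    ((Submodule.span_singleton_le_iff_mem _ _).2 (iterate_mem_filtration k.lt_succ_self)))
  rcases Nat.lt_succ_iff_lt_or_eq.1 hi with h | rfl
  · exact Submodule.mem_sup_left (iterate_mem_filtration h)
  · exact Submodule.mem_sup_right (Submodule.mem_span_singleton_self _)

end Filtration

variable {A : Type*} {N : Type*} [CommRing A] [Algebra ℂ A] [AddCommGroup N] [Module A N]
  {d : Derivation ℂ A A} {D : N →+ N}

theorem map_mem_filtration (hD : IsDifferential d D) {x y : N} {k : ℕ}
    (hy : y ∈ filtration A D x k) : D y ∈ filtration A D x (k + 1) := by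
  refine Submodule.span_induction (p := fun y _ => D y ∈ filtration A D x (k + 1)) ?_ ?_ ?_ ?_ hy
  · rintro _ ⟨i, hi, rfl⟩
    change D (D^[i] x) ∈ _
    rw [← Function.iterate_succ_apply' D]
    exact iterate_mem_filtration (Nat.succ_lt_succ hi)
  · rw [map_zero]
    exact zero_mem _
  · intro u v _ _ hu hv
    rw [map_add]
    exact add_mem hu hv
  · intro a u hu h
    rw [hD]
    exact add_mem (Submodule.smul_mem _ _ h)
      (Submodule.smul_mem _ _ (filtration_mono x k.le_succ hu))

theorem smul_iterate_sub_mem (hD : IsDifferential d D) (a : A) (x : N) (k : ℕ) :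
    a • D^[k] x - D^[k] (a • x) ∈ filtration A D x k := by
  induction k with
  | zero => simp
  | succ k ih =>
    have h := hD.map_mem_filtration ih
    rw [map_sub, hD, ← Function.iterate_succ_apply' D, ← Function.iterate_succ_apply' D] at h
    have h2 := Submodule.smul_mem _ (d a) (iterate_mem_filtration (A := A) (D := D) (x := x)
      k.lt_succ_self)
    convert sub_mem h h2 using 1
    abel

theorem filtration_smul_le (hD : IsDifferential d D) (a : A) (x : N) (k : ℕ) :
    filtration A D (a • x) k ≤ filtration A D x k := by
  refine filtration_le fun i hi => ?_
  have h := sub_mem (Submodule.smul_mem _ a (iterate_mem_filtration (A := A) (D := D) (x := x) hi))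
    (filtration_mono x hi.le (hD.smul_iterate_sub_mem a x i))
  rwa [sub_sub_cancel] at h

/-- Moving `q` past `D^[k + 1]` produces `-(k + 1) d(q) D^[k]` modulo lower order, and the main term
vanishes because `q` kills `x`. -/
theorem smul_iterate_succ_add_mem (hD : IsDifferential d D) {q : A} {x : N} (hq : q • x = 0)
    (k : ℕ) :
    q • D^[k + 1] x + ((k + 1 : ℕ) * d q : A) • D^[k] x ∈ filtration A D x k := by
  induction k with
  | zero =>
    have h := hD q x
    rw [hq, map_zero] at h
    simp [← h]
  | succ k ih =>
    have h := hD.map_mem_filtration ih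
    rw [map_add, hD, hD, ← Function.iterate_succ_apply' D, ← Function.iterate_succ_apply' D] at h
    have h2 := Submodule.smul_mem _ (d ((k + 1 : ℕ) * d q : A))
      (iterate_mem_filtration (A := A) (D := D) (x := x) k.lt_succ_self)
    convert sub_mem h h2 using 1
    push_cast
    module

theorem smul_mem_filtration (hD : IsDifferential d D) {q : A} {x y : N} (hq : q • x = 0) {k : ℕ}
    (hy : y ∈ filtration A D x (k + 1)) : q • y ∈ filtration A D x k := by
  suffices h : filtration A D x (k + 1) ≤ (filtration A D x k).comap (LinearMap.lsmul A N q) from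
    h hy
  refine filtration_le fun i hi => ?_
  change q • D^[i] x ∈ filtration A D x k
  rcases i with - | i
  · simp [hq]
  · have hi' : i < k := by omega
    have h := filtration_mono x hi'.le (hD.smul_iterate_succ_add_mem hq i)
    rwa [add_mem_cancel_right (Submodule.smul_mem _ _ (iterate_mem_filtration hi'))] at h

/-- Modulo lower order, `D^[k] x` has no more annihilators than `x`. Multiplication by `q` lowers
the order by one and turns the leading coefficient `a` into a unit multiple of `a * d q`; since `d q
∉ Q`, induction gives `a ∈ Q`. -/
theorem smul_eq_zero_of_smul_iterate_mem (hD : IsDifferential d D) {Q : Ideal A} [Q.IsPrime]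
    {x : N} (hx : ∀ a : A, a ∈ Q ↔ a • x = 0) {q : A} (hq : q ∈ Q) (hdq : d q ∉ Q) {a : A} {k : ℕ}
    (ha : a • D^[k] x ∈ filtration A D x k) : a ∈ Q := by
  induction k generalizing a with
  | zero =>
    rw [filtration_zero, Submodule.mem_bot] at ha
    exact (hx a).2 ha
  | succ k ih =>
    have h1 := hD.smul_mem_filtration ((hx q).1 hq) ha
    have h2 := Submodule.smul_mem _ a (hD.smul_iterate_succ_add_mem ((hx q).1 hq) k)
    rw [smul_comm] at h1
    rw [smul_add, add_mem_cancel_left h1, smul_smul] at h2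
    have h3 := ih h2
    rw [mul_left_comm, natCast_mul_mem_iff k.succ_ne_zero] at h3
    exact (Ideal.IsPrime.mem_or_mem ‹_› h3).resolve_right hdq

theorem exists_mem_filtration (hD : IsDifferential d D) (hs : IsDifferentiallySimple A D) {x : N}
    (hx : x ≠ 0) (y : N) : ∃ k, y ∈ filtration A D x k := by
  have hdir : Directed (· ≤ ·) (filtration A D x) := (filtration_mono x).directed_le
  have h : ⨆ k, filtration A D x k = ⊤ := by
    refine hs _ (fun n hn => ?_) fun h => ?_
    · rw [Submodule.mem_iSup_of_directed _ hdir] at hn ⊢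
      obtain ⟨k, hk⟩ := hn
      exact ⟨k + 1, hD.map_mem_filtration hk⟩
    · have : x ∈ ⨆ k, filtration A D x k :=
        Submodule.mem_iSup_of_mem 1 (iterate_mem_filtration (i := 0) one_pos)
      rw [h] at this
      exact hx this
  rw [← Submodule.mem_iSup_of_directed _ hdir, h]
  trivial

/-- For `b ∉ Q`, the vector `b • x` is non-zero and so generates `x`. The order of the expression of
`x` in terms of `b • x` can be lowered until `x = r • b • x`, which makes `b` invertible modulo `Q`.
-/
theorem isMaximal_of_annihilator (hD : IsDifferential d D) (hs : IsDifferentiallySimple A D)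
    {Q : Ideal A} [hQ : Q.IsPrime] {x : N} (hx : ∀ a : A, a ∈ Q ↔ a • x = 0) {q : A} (hq : q ∈ Q)
    (hdq : d q ∉ Q) : Q.IsMaximal := by
  rw [Ideal.isMaximal_iff]
  refine ⟨Q.ne_top_iff_one.1 hQ.ne_top, fun J b hQJ hb hbJ => ?_⟩
  have key : ∀ k, x ∈ filtration A D (b • x) (k + 1) → x ∈ filtration A D (b • x) 1 := by
    intro k
    induction k with
    | zero => exact id
    | succ k ih =>
      intro h
      refine ih ?_
      rw [filtration_succ, Submodule.mem_sup] at h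
      obtain ⟨u, hu, v, hv, huv⟩ := h
      obtain ⟨r, rfl⟩ := Submodule.mem_span_singleton.1 hv
      have h1 := hD.smul_iterate_sub_mem r (b • x) (k + 1)
      -- All other terms of `x = u + r • D^[k + 1] (b • x)` have lower order in `x`, so the leading
      -- coefficient `r • b` is in `Q`. Then `r • b • x = 0`, and the top term drops to lower order
      -- in `b • x`.
      have h2 : r • b ∈ Q := by
        refine hD.smul_eq_zero_of_smul_iterate_mem hx hq hdq (k := k + 1) ?_
        have h3 := hD.smul_iterate_sub_mem (r • b) x (k + 1)
        rw [smul_assoc r b x] at h3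
        have h4 : x ∈ filtration A D x (k + 1) :=
          iterate_mem_filtration (i := 0) k.succ_pos
        have h5 := hD.filtration_smul_le b x (k + 1)
        have h6 := add_mem h3 (sub_mem (sub_mem h4 (h5 hu)) (h5 h1))
        convert h6 using 1
        rw [eq_sub_of_add_eq' huv]
        abel
      rw [hx, smul_assoc] at h2
      rw [h2, iterate_map_zero, sub_zero] at h1
      have h7 := add_mem hu h1
      rwa [huv] at h7
  obtain ⟨k, hk⟩ := hD.exists_mem_filtration hs (fun h => hb ((hx b).2 h)) x
  have h1 := key k (filtration_mono _ k.le_succ hk)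
  rw [filtration_succ, filtration_zero, bot_sup_eq, Submodule.mem_span_singleton] at h1
  obtain ⟨r, hr⟩ := h1
  have h2 : 1 - r * b ∈ Q := by
    rw [hx, sub_smul, one_smul, mul_smul]
    exact sub_eq_zero.2 hr.symm
  rw [← sub_add_cancel 1 (r * b)]
  exact add_mem (hQJ h2) (J.mul_mem_left r hbJ)

end IsDifferential

/-! ### Coefficients and degrees under left multiplication by `z` -/

namespace OreExtension

variable {A : Type u} [CommRing A] [Algebra ℂ A]

theorem mulZ_apply (δ : Derivation ℂ A A) (f : A[X]) :
    mulZ δ f = X * f + coeffDerivation δ f := rfl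

theorem coeff_mulZ_succ (δ : Derivation ℂ A A) (f : A[X]) (n : ℕ) :
    (mulZ δ f).coeff (n + 1) = f.coeff n + δ (f.coeff (n + 1)) := by
  rw [mulZ_apply, coeff_add, coeff_X_mul, coeff_coeffDerivation]

theorem coeff_mulZ_zero (δ : Derivation ℂ A A) (f : A[X]) :
    (mulZ δ f).coeff 0 = δ (f.coeff 0) := by
  rw [mulZ_apply, coeff_add, mul_coeff_zero, coeff_X_zero, zero_mul, zero_add,
    coeff_coeffDerivation]

theorem mulZ_X_mul (δ : Derivation ℂ A A) (f : A[X]) : mulZ δ (X * f) = X * mulZ δ f := by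
  simp only [mulZ_apply, Derivation.leibniz, coeffDerivation_X, smul_eq_mul]
  ring

theorem mulZ_pow_succ_apply (δ : Derivation ℂ A A) (j : ℕ) (f : A[X]) :
    (mulZ δ ^ (j + 1)) f = mulZ δ ((mulZ δ ^ j) f) := by
  rw [pow_succ', Module.End.mul_apply]

theorem coeff_mulZ_pow_of_lt (δ : Derivation ℂ A A) {f : A[X]} {n : ℕ} (hf : f.natDegree ≤ n)
    (j : ℕ) {k : ℕ} (hk : n + j < k) : ((mulZ δ ^ j) f).coeff k = 0 := by
  induction j generalizing k with
  | zero => exact coeff_eq_zero_of_natDegree_lt (hf.trans_lt hk)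
  | succ j ih =>
    obtain ⟨k, rfl⟩ : ∃ l, k = l + 1 := ⟨k - 1, by omega⟩
    rw [mulZ_pow_succ_apply, coeff_mulZ_succ, ih (by omega), ih (by omega), map_zero, add_zero]

theorem coeff_mulZ_pow_add (δ : Derivation ℂ A A) {f : A[X]} {n : ℕ} (hf : f.natDegree ≤ n)
    (j : ℕ) : ((mulZ δ ^ j) f).coeff (n + j) = f.coeff n := by
  induction j with
  | zero => rfl
  | succ j ih =>
    rw [mulZ_pow_succ_apply, ← add_assoc, coeff_mulZ_succ, ih,
      coeff_mulZ_pow_of_lt δ hf j (Nat.lt_succ_self _), map_zero, add_zero]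

/-- In an `A`-submodule of `A[z; δ]` stable under `z`, whose non-zero elements have degree at least
that of `f`, no element has degree less than `f` modulo a prime ideal avoiding the leading
coefficient of `f`. -/
theorem exists_coeff_notMem_of_mem {δ : Derivation ℂ A A} {L : Submodule A A[X]}
    (hL : ∀ g ∈ L, mulZ δ g ∈ L) {f : A[X]} (hf : f ∈ L)
    (hmin : ∀ g ∈ L, g ≠ 0 → f.natDegree ≤ g.natDegree) {P : Ideal A} [hP : P.IsPrime]
    (hc : f.leadingCoeff ∉ P) {g : A[X]} (hg : g ∈ L) :
    (∀ i, g.coeff i ∈ P) ∨ ∃ i, f.natDegree ≤ i ∧ g.coeff i ∉ P := by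
  induction hm : g.natDegree using Nat.strong_induction_on generalizing g with
  | _ m ih =>
    by_cases hg0 : g = 0
    · left
      simp [hg0]
    have hfg := hmin g hg hg0
    by_cases hb : g.coeff m ∈ P
    swap
    · exact Or.inr ⟨m, hm ▸ hfg, hb⟩
    obtain ⟨j, hj⟩ := Nat.exists_eq_add_of_le (hm ▸ hfg)
    have hpow : ∀ j, (mulZ δ ^ j) f ∈ L := by
      intro j
      induction j with
      | zero => exact hf
      | succ j ihj =>
        rw [mulZ_pow_succ_apply]
        exact hL _ ihj
    -- Pseudo-division by `f` cancels the top term of `g`. The subtracted part has coefficients in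
    -- `P` and `f.leadingCoeff ∉ P`, so the set of indices with coefficient in `P` does not change.
    set g' : A[X] := f.leadingCoeff • g - g.coeff m • (mulZ δ ^ j) f with hg'
    have hg'L : g' ∈ L := sub_mem (L.smul_mem _ hg) (L.smul_mem _ (hpow j))
    have hcoeff : ∀ i, g'.coeff i ∈ P ↔ g.coeff i ∈ P := by
      intro i
      rw [hg', coeff_sub, coeff_smul, coeff_smul, smul_eq_mul, smul_eq_mul,
        Submodule.sub_mem_iff_left _ (P.mul_mem_right _ hb)]
      exact ⟨fun h => (hP.mem_or_mem h).resolve_left hc, P.mul_mem_left _⟩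
    have hzero : ∀ i, m ≤ i → g'.coeff i = 0 := by
      intro i hi
      rw [hg', coeff_sub, coeff_smul, coeff_smul, smul_eq_mul, smul_eq_mul]
      rcases hi.eq_or_lt with rfl | hi
      · nth_rewrite 3 [hj]
        rw [coeff_mulZ_pow_add δ le_rfl, leadingCoeff, mul_comm, sub_self]
      · rw [coeff_eq_zero_of_natDegree_lt (hm.trans_lt hi),
          coeff_mulZ_pow_of_lt δ le_rfl j (hj ▸ hi), mul_zero, mul_zero, sub_zero]
    by_cases hg'0 : g' = 0
    · left
      intro i
      rw [← hcoeff, hg'0, coeff_zero]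
      exact zero_mem P
    · have hlt : g'.natDegree < m := by
        by_contra! h
        exact hg'0 (leadingCoeff_eq_zero.1 (hzero _ h))
      simpa only [hcoeff] using ih _ hlt hg'L rfl

end OreExtension

/-! ### Simple modules as quotients of `A[z; δ]` -/

namespace IsDifferential

open OreExtension

variable {A : Type u} {N : Type*} [CommRing A] [Algebra ℂ A] [AddCommGroup N] [Module A N]
  {d : Derivation ℂ A A} {D : N →+ N}

variable (A D) in
/-- The map `∑ aᵢ zⁱ ↦ ∑ aᵢ Dⁱ x`. -/
def evalAt (x : N) : A[X] →ₗ[A] N :=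
  Polynomial.lsum fun i => LinearMap.toSpanSingleton A N (D^[i] x)

omit [Algebra ℂ A] in
theorem evalAt_monomial (x : N) (i : ℕ) (a : A) :
    evalAt A D x (monomial i a) = a • D^[i] x := by
  simp [evalAt, Polynomial.lsum_apply, Polynomial.sum_monomial_index]

omit [Algebra ℂ A] in
theorem evalAt_C (x : N) (a : A) : evalAt A D x (C a) = a • x :=
  evalAt_monomial x 0 a

theorem evalAt_mulZ (hD : IsDifferential d D) (x : N) (f : A[X]) :
    evalAt A D x (mulZ d f) = D (evalAt A D x f) := by
  induction f using Polynomial.induction_on' with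
  | add p q hp hq => simp only [map_add, hp, hq]
  | monomial n a =>
    rw [mulZ_monomial, map_add, evalAt_monomial, evalAt_monomial, evalAt_monomial, hD,
      Function.iterate_succ_apply']

theorem map_evalAt_eq_bot_or_top (hD : IsDifferential d D) (hs : IsDifferentiallySimple A D)
    (x : N) {S : Submodule A A[X]} (hS : ∀ f ∈ S, mulZ d f ∈ S) :
    S.map (evalAt A D x) = ⊥ ∨ S.map (evalAt A D x) = ⊤ := by
  refine or_iff_not_imp_left.2 (hs _ ?_)
  rintro _ ⟨f, hf, rfl⟩
  exact ⟨_, hS f hf, hD.evalAt_mulZ x f⟩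

theorem exists_evalAt_eq_zero [Nontrivial A] (hD : IsDifferential d D)
    (hs : IsDifferentiallySimple A D) (x : N) : ∃ f ≠ 0, evalAt A D x f = 0 := by
  -- The commutative product `X * f` is right multiplication of `f` by `z` in `A[z; δ]`, so this
  -- range is the left ideal generated by `z`. Either `z` kills `x`, or `x = (f z) x` for some `f`
  -- and `1 - f z` kills `x`.
  rcases hD.map_evalAt_eq_bot_or_top hs x (S := LinearMap.range (LinearMap.mulLeft A (X : A[X])))
    (by rintro _ ⟨f, rfl⟩; exact ⟨_, (mulZ_X_mul d f).symm⟩) with h | h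
  · refine ⟨X, X_ne_zero, ?_⟩
    rw [← Submodule.mem_bot A, ← h]
    exact ⟨X, ⟨1, by simp⟩, rfl⟩
  · have hx : x ∈ (⊤ : Submodule A N) := trivial
    rw [← h] at hx
    obtain ⟨_, ⟨f, rfl⟩, hf⟩ := hx
    refine ⟨C 1 - X * f, fun h0 => ?_, ?_⟩
    · simpa using congrArg (fun p : A[X] => p.coeff 0) h0
    · rw [map_sub, evalAt_C, one_smul, sub_eq_zero]
      exact hf.symm

/-- Here `c` is the leading coefficient of a relation `f` of least degree killing `x`. For a prime
`d`-ideal `P ≠ 0`, simplicity gives `P N = N`, hence a relation `1 - g` with `g` over `P`; reducing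
it by `f` is impossible unless `c ∈ P`. -/
theorem exists_mem_of_isPrime [IsDomain A] (hD : IsDifferential d D)
    (hs : IsDifferentiallySimple A D) {x : N} (hx : ∀ a : A, a • x = 0 → a = 0) :
    ∃ c : A, c ≠ 0 ∧ ∀ P : Ideal A, P.IsPrime → (∀ a ∈ P, d a ∈ P) → P ≠ ⊥ → c ∈ P := by
  classical
  have hex : ∃ n, ∃ f : A[X], f ≠ 0 ∧ evalAt A D x f = 0 ∧ f.natDegree = n := by
    obtain ⟨f, hf0, hf⟩ := hD.exists_evalAt_eq_zero hs x
    exact ⟨_, f, hf0, hf, rfl⟩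
  obtain ⟨f, hf0, hfx, hfn⟩ := Nat.find_spec hex
  have hmin : ∀ g ∈ LinearMap.ker (evalAt A D x), g ≠ 0 → f.natDegree ≤ g.natDegree :=
    fun g hg hg0 => hfn ▸ Nat.find_min' hex ⟨g, hg0, hg, rfl⟩
  have hker : ∀ g ∈ LinearMap.ker (evalAt A D x), mulZ d g ∈ LinearMap.ker (evalAt A D x) := by
    intro g hg
    rw [LinearMap.mem_ker] at hg ⊢
    rw [hD.evalAt_mulZ, hg, map_zero]
  have hpos : 0 < f.natDegree := by
    by_contra! h
    rw [eq_C_of_natDegree_le_zero h, evalAt_C] at hfx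
    rw [eq_C_of_natDegree_le_zero h, hx _ hfx, C_0] at hf0
    exact hf0 rfl
  refine ⟨f.leadingCoeff, leadingCoeff_ne_zero.2 hf0, fun P hP hdP hP0 => ?_⟩
  by_contra hc
  let S : Submodule A A[X] :=
    { carrier := {g | ∀ i, g.coeff i ∈ P}
      add_mem' := fun hp hq i => by
        rw [coeff_add]
        exact add_mem (hp i) (hq i)
      zero_mem' := fun i => by simp
      smul_mem' := fun a g hg i => by
        rw [coeff_smul]
        exact P.mul_mem_left _ (hg i) }
  have hS : ∀ g ∈ S, mulZ d g ∈ S := by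
    rintro g hg (- | i)
    · rw [coeff_mulZ_zero]
      exact hdP _ (hg 0)
    · rw [coeff_mulZ_succ]
      exact add_mem (hg i) (hdP _ (hg _))
  obtain ⟨p, hp, hp0⟩ := Submodule.exists_mem_ne_zero_of_ne_bot hP0
  rcases hD.map_evalAt_eq_bot_or_top hs x hS with h | h
  · have hx0 : p • x = 0 := by
      rw [← Submodule.mem_bot A, ← h]
      refine ⟨C p, fun i => ?_, evalAt_C x p⟩
      rw [coeff_C]
      split_ifs
      exacts [hp, zero_mem P]
    exact hp0 (hx p hx0)
  · have hxS : x ∈ (⊤ : Submodule A N) := trivial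
    rw [← h] at hxS
    obtain ⟨g, hg, hgx⟩ := hxS
    have hl : C 1 - g ∈ LinearMap.ker (evalAt A D x) := by
      rw [LinearMap.mem_ker, map_sub, evalAt_C, one_smul, hgx, sub_self]
    have h1 : (1 : A) ∉ P := P.ne_top_iff_one.1 hP.ne_top
    -- The relation `C 1 - g` has constant coefficient outside `P` and all others in `P`, while `f`
    -- has positive degree: both alternatives fail.
    rcases exists_coeff_notMem_of_mem hker hfx hmin hc hl with h2 | ⟨i, hi, h2⟩
    · have h3 := h2 0
      rw [coeff_sub, coeff_C_zero, Submodule.sub_mem_iff_left _ (hg 0)] at h3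
      exact h1 h3
    · rw [coeff_sub, coeff_C_of_ne_zero (hpos.trans_le hi).ne', zero_sub, neg_mem_iff] at h2
      exact h2 (hg i)

theorem isDerivationPrimitive [Algebra.FiniteType ℂ A] [Nontrivial N] (hD : IsDifferential d D)
    (hs : IsDifferentiallySimple A D) (hf : ∀ a : A, (∀ n : N, a • n = 0) → a = 0) :
    IsDerivationPrimitive d := by
  have : IsNoetherianRing A := Algebra.FiniteType.isNoetherianRing ℂ A
  have : IsJacobsonRing A := isJacobsonRing_of_finiteType (A := ℂ)
  obtain ⟨Q, hQ⟩ := associatedPrimes.nonempty A N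
  rw [AssociatedPrimes.mem_iff, isAssociatedPrime_iff] at hQ
  obtain ⟨hQ, x, hxQ⟩ := hQ
  have hx : ∀ a : A, a ∈ Q ↔ a • x = 0 := by
    intro a
    rw [hxQ, Submodule.mem_colon_singleton, Submodule.mem_bot]
  have hcore : HasTrivialCore d Q := by
    intro J hJ hJQ
    refine (Submodule.eq_bot_iff _).2 fun a ha => hf a fun n => ?_
    have hx0 : x ≠ 0 := by
      rintro rfl
      exact hQ.ne_top ((Ideal.eq_top_iff_one _).2 ((hx 1).2 (smul_zero _)))
    obtain ⟨k, hk⟩ := hD.exists_mem_filtration hs hx0 n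
    -- A `d`-ideal that kills `x` kills every `D^[i] x`, hence all of `N`.
    have hJk : ∀ i, ∀ b ∈ J, b • D^[i] x = 0 := by
      intro i
      induction i with
      | zero => exact fun b hb => (hx b).1 (hJQ hb)
      | succ i ih =>
        intro b hb
        have h := hD b (D^[i] x)
        rw [ih b hb, ih _ (hJ b hb), map_zero, add_zero] at h
        rw [Function.iterate_succ_apply', ← h]
    have hle : filtration A D x k ≤ LinearMap.ker (LinearMap.lsmul A N a) :=
      filtration_le fun i _ => hJk i a ha
    exact hle hk
  have : IsDomain A := hcore.isDomain
  by_cases hQ0 : Q = ⊥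
  · obtain ⟨c, hc0, hc⟩ := hD.exists_mem_of_isPrime hs (x := x) fun a ha => by
      rwa [← hx, hQ0, Ideal.mem_bot] at ha
    -- In a Jacobson domain the maximal ideals intersect in zero. The core of such an `M` is a prime
    -- `d`-ideal without `c`, hence zero.
    obtain ⟨M, hM, hcM⟩ : ∃ M : Ideal A, M.IsMaximal ∧ c ∉ M := by
      by_contra! h
      have hj : c ∈ (⊥ : Ideal A).jacobson := by
        rw [Ideal.jacobson, Ideal.mem_sInf]
        exact fun M hM => h M hM.2
      rw [IsJacobsonRing.out ‹_› (Ideal.isPrime_bot (α := A)).isRadical] at hj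
      exact hc0 hj
    have hM' := hM.isPrime
    refine ⟨M, hM, fun J hJ hJM => le_bot_iff.1 ?_⟩
    have hle : J ≤ iterateCore d M := by
      intro a ha n
      refine hJM ?_
      induction n with
      | zero => exact ha
      | succ n ih =>
        rw [Function.iterate_succ_apply']
        exact hJ _ ih
    have hbot : iterateCore d M = ⊥ := by
      by_contra h
      exact hcM (iterateCore_le d M
        (hc _ (isPrime_iterateCore d M) (fun _ => derivation_mem_iterateCore) h))
    exact hbot ▸ hle
  · obtain ⟨q, hq, hdq⟩ : ∃ q ∈ Q, d q ∉ Q := by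
      by_contra! h
      exact hQ0 (hcore Q h le_rfl)
    exact ⟨Q, hD.isMaximal_of_annihilator hs hx hq hdq, hcore⟩

end IsDifferential

/-! ## Primitivity of rings generated by `A` and an element of degree one -/

section Primitive

variable {A S : Type u} [CommRing A] [Algebra ℂ A] [Ring S] (ι : A →+* S)

/-- If `S` is generated by `A` and an element `z` with `z a - a z = d(a)`, then the primitivity
of `S` implies that of `A` with respect to `d`. -/
theorem isDerivationPrimitive_of_isLeftPrimitiveRing [Algebra.FiniteType ℂ A]
    {d : Derivation ℂ A A} (hι : Function.Injective ι) {z : S}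
    (hz : ∀ a, z * ι a = ι a * z + ι (d a))
    (hgen : ∀ T : Subring S, (∀ a, ι a ∈ T) → z ∈ T → ∀ s, s ∈ T)
    (h : IsLeftPrimitiveRing S) : IsDerivationPrimitive d := by
  obtain ⟨N, _, _, hsimple, hfaith⟩ := h
  let _ : Module A N := Module.compHom N ι
  have hsmul : ∀ (a : A) (n : N), a • n = ι a • n := fun _ _ => rfl
  have : Nontrivial N := IsSimpleModule.nontrivial S N
  let D : N →+ N := DistribSMul.toAddMonoidHom N z
  have hDz : ∀ n, D n = z • n := fun _ => rfl
  have hD : IsDifferential d D := by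
    intro a n
    rw [hDz, hDz, hsmul, hsmul, hsmul, smul_smul, smul_smul, hz, add_smul]
  refine hD.isDerivationPrimitive (fun P hP hP0 => ?_) fun a ha => ?_
  -- The elements of `S` preserving `P` form a subring containing `A` and `z`, so `P` is an
  -- `S`-submodule.
  · let T : Subring S :=
      { carrier := {s | ∀ n ∈ P, s • n ∈ P}
        mul_mem' := fun {s t} hs ht n hn => by
          rw [mul_smul]
          exact hs _ (ht n hn)
        one_mem' := fun n hn => by rwa [one_smul]
        add_mem' := fun {s t} hs ht n hn => by
          rw [add_smul]
          exact add_mem (hs n hn) (ht n hn)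
        zero_mem' := fun n _ => by
          rw [zero_smul]
          exact zero_mem P
        neg_mem' := fun {s} hs n hn => by
          rw [neg_smul]
          exact neg_mem (hs n hn) }
    have hT := hgen T (fun a n hn => P.smul_mem a hn) hP
    let P' : Submodule S N :=
      { P.toAddSubgroup with smul_mem' := fun s n hn => hT s n hn }
    have hP' : ∀ n, n ∈ P' ↔ n ∈ P := fun _ => Iff.rfl
    rcases eq_bot_or_eq_top P' with h | h
    · refine absurd ((Submodule.eq_bot_iff _).2 fun n hn => ?_) hP0
      rwa [← hP', h, Submodule.mem_bot] at hn
    · refine Submodule.eq_top_iff'.2 fun n => ?_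
      rw [← hP', h]
      trivial
  · refine hι ?_
    rw [map_zero]
    refine FaithfulSMul.eq_of_smul_eq_smul (α := N) fun n => ?_
    rw [zero_smul]
    exact ha n

/-- If every non-zero two-sided ideal of `S` meets `A`, then `S` is primitive as soon as some
maximal ideal with trivial core generates a proper left ideal. -/
theorem isLeftPrimitiveRing_of_hasTrivialCore {d : Derivation ℂ A A} {z : S}
    (hz : ∀ a, z * ι a = ι a * z + ι (d a)) {M : Ideal A} [hM : M.IsMaximal]
    (hcore : HasTrivialCore d M) {L₀ : Ideal S} (hL₀ : L₀ ≠ ⊤) (hML₀ : ∀ a ∈ M, ι a ∈ L₀)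
    (hI : ∀ I : Ideal S, I.IsTwoSided → I ≠ ⊥ → ∃ a ≠ 0, ι a ∈ I) :
    IsLeftPrimitiveRing S := by
  obtain ⟨L, hL, hL₀L⟩ := Ideal.exists_le_maximal L₀ hL₀
  refine ⟨S ⧸ L, inferInstance, inferInstance, isSimpleModule_iff_isCoatom.2 hL.out, ?_⟩
  rw [← Module.annihilator_eq_bot]
  by_contra hann
  set I := Module.annihilator S (S ⧸ L)
  obtain ⟨a, ha0, ha⟩ := hI I inferInstance hann
  have hIL : I ≤ L := by
    intro s hs
    have h := Module.mem_annihilator.1 hs (Submodule.Quotient.mk 1)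
    rwa [← Submodule.Quotient.mk_smul, Submodule.Quotient.mk_eq_zero, smul_eq_mul, mul_one] at h
  let J : Ideal A :=
    { carrier := {b | ι b ∈ I}
      add_mem' := fun {b c} hb hc => by
        change ι (b + c) ∈ I
        rw [map_add]
        exact add_mem hb hc
      zero_mem' := by
        change ι 0 ∈ I
        rw [map_zero]
        exact zero_mem I
      smul_mem' := fun b c hc => by
        change ι (b * c) ∈ I
        rw [map_mul]
        exact I.mul_mem_left _ hc }
  have hJ : ∀ b, b ∈ J ↔ ι b ∈ I := fun _ => Iff.rfl
  -- Commutators with `z` make `J` a `d`-ideal. It lies in `M`, since an element of `J` invertible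
  -- modulo `M` would put `1` in `L`.
  have hJbot : J = ⊥ := by
    refine hcore J (fun b hb => ?_) fun b hb => ?_
    · rw [hJ] at hb ⊢
      rw [← sub_eq_of_eq_add' (hz b)]
      exact sub_mem (I.mul_mem_left _ hb) (Ideal.IsTwoSided.mul_mem_of_left _ hb)
    · by_contra hbM
      obtain ⟨c, hc⟩ := hM.exists_inv hbM
      obtain ⟨m, hm, hcm⟩ := hc
      refine hL.ne_top ((Ideal.eq_top_iff_one L).2 ?_)
      rw [← map_one ι, ← hcm, map_add, map_mul]
      exact add_mem (L.mul_mem_left _ (hIL hb)) (hL₀L (hML₀ m hm))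
  refine ha0 ?_
  rw [← Ideal.mem_bot, ← hJbot]
  exact ha

end Primitive

/-! ### The subring `A` of `A[z; δ]` and commutators with its elements -/

namespace OreExtension

variable {A : Type u} [CommRing A] [Algebra ℂ A] (δ : Derivation ℂ A A)

theorem mulOp_apply (f g : A[X]) : mulOp δ f g = f.sum fun i a => a • (mulZ δ ^ i) g := by
  induction f using Polynomial.induction_on' with
  | add p q hp hq =>
    rw [map_add, LinearMap.add_apply, hp, hq, sum_add_index] <;> simp [add_smul]
  | monomial n a => rw [mulOp_monomial, sum_monomial_index _ _ (by simp), LinearMap.smul_apply]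

/-- The inclusion of `A` in `A[z; δ]`. -/
def inclusion : A →+* OreExtension δ where
  toFun := mono δ 0
  map_one' := rfl
  map_mul' a b := (mono_zero_mul δ a b).symm
  map_zero' := map_zero (monomial 0 : A →ₗ[A] A[X])
  map_add' a b := map_add (monomial 0 : A →ₗ[A] A[X]) a b

theorem inclusion_injective : Function.Injective (inclusion δ) :=
  C_injective

theorem z_mul_inclusion (a : A) :
    mono δ 1 1 * inclusion δ a = inclusion δ a * mono δ 1 1 + inclusion δ (δ a) :=
  sub_eq_iff_eq_add'.1 (z_mul_sub δ a)

theorem mem_subring (T : Subring (OreExtension δ)) (hA : ∀ a, inclusion δ a ∈ T)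
    (hz : mono δ 1 1 ∈ T) (s : OreExtension δ) : s ∈ T := by
  change A[X] at s
  induction s using Polynomial.induction_on' with
  | add p q hp hq => exact T.add_mem hp hq
  | monomial n a =>
    have h := T.mul_mem (hA a) (T.pow_mem hz n)
    change mono δ 0 a * mono δ 1 1 ^ n ∈ T at h
    rw [← mono_eq] at h
    exact h

theorem coeff_mulZ_pow_succ_C (b : A) (i : ℕ) :
    ((mulZ δ ^ (i + 1)) (C b)).coeff i = (i + 1 : ℕ) * δ b := by
  induction i with
  | zero => rw [mulZ_pow_succ_apply, coeff_mulZ_zero]; simp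
  | succ i ih =>
    have h := coeff_mulZ_pow_add δ (natDegree_C b).le (i + 1)
    rw [zero_add, coeff_C_zero] at h
    rw [mulZ_pow_succ_apply, coeff_mulZ_succ, ih, h]
    push_cast
    ring

theorem coeff_mulOp_C {f : A[X]} {n : ℕ} (hf : f.natDegree ≤ n) (b : A) (k : ℕ) :
    (mulOp δ f (C b)).coeff k =
      ∑ i ∈ Finset.range (n + 1), f.coeff i * ((mulZ δ ^ i) (C b)).coeff k := by
  rw [mulOp_apply, sum_over_range' _ (by simp) (n + 1) (Nat.lt_succ_of_le hf), finsetSum_coeff]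
  simp only [coeff_smul, smul_eq_mul]

theorem coeff_mulZ_pow_C_of_lt (b : A) {i k : ℕ} (h : i < k) :
    ((mulZ δ ^ i) (C b)).coeff k = 0 :=
  coeff_mulZ_pow_of_lt δ (natDegree_C b).le i (by rwa [zero_add])

theorem coeff_mulZ_pow_C_self (b : A) (i : ℕ) : ((mulZ δ ^ i) (C b)).coeff i = b := by
  simpa using coeff_mulZ_pow_add δ (natDegree_C b).le i

theorem coeff_commutator_of_lt {f : A[X]} {m : ℕ} (hf : f.natDegree = m + 1) (b : A) {k : ℕ}
    (hk : m < k) : (mulOp δ f (C b) - b • f).coeff k = 0 := by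
  rw [coeff_sub, coeff_mulOp_C δ hf.le, Finset.sum_range_succ, Finset.sum_eq_zero, zero_add,
    coeff_smul, smul_eq_mul]
  · rcases (Nat.succ_le_of_lt hk).eq_or_lt with rfl | hk
    · rw [Nat.succ_eq_add_one, coeff_mulZ_pow_C_self, mul_comm, sub_self]
    · rw [coeff_mulZ_pow_C_of_lt δ b hk, coeff_eq_zero_of_natDegree_lt (hf.trans_lt hk), mul_zero,
        mul_zero, sub_zero]
  · intro i hi
    rw [coeff_mulZ_pow_C_of_lt δ b (by rw [Finset.mem_range] at hi; omega), mul_zero]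

theorem coeff_commutator {f : A[X]} {m : ℕ} (hf : f.natDegree = m + 1) (b : A) :
    (mulOp δ f (C b) - b • f).coeff m = (m + 1 : ℕ) * (f.coeff (m + 1) * δ b) := by
  rw [coeff_sub, coeff_mulOp_C δ hf.le, Finset.sum_range_succ, Finset.sum_range_succ,
    Finset.sum_eq_zero, zero_add, coeff_smul, smul_eq_mul, coeff_mulZ_pow_C_self,
    coeff_mulZ_pow_succ_C]
  · ring
  · intro i hi
    rw [coeff_mulZ_pow_C_of_lt δ b (Finset.mem_range.1 hi), mul_zero]

-- The commutator of `f` with `b`, where `δ b ≠ 0`, has degree exactly one less than `f`, by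
-- `coeff_commutator`. Stating this for additive subgroups lets it serve the ring and its opposite
-- alike.
variable {δ} in
theorem exists_inclusion_mem [IsDomain A] (hδ : δ ≠ 0) (I : AddSubgroup (OreExtension δ))
    (hl : ∀ r, ∀ s ∈ I, r * s ∈ I) (hr : ∀ r, ∀ s ∈ I, s * r ∈ I) (hI : I ≠ ⊥) :
    ∃ a ≠ 0, inclusion δ a ∈ I := by
  have : CharZero A := charZero_of_injective_algebraMap (algebraMap ℂ A).injective
  obtain ⟨b, hb⟩ : ∃ b, δ b ≠ 0 := by
    by_contra! h
    exact hδ (Derivation.ext h)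
  obtain ⟨f, hf, hf0⟩ : ∃ f : A[X], (show OreExtension δ from f) ∈ I ∧ f ≠ 0 := by
    by_contra! h
    exact hI ((AddSubgroup.eq_bot_iff_forall I).2 h)
  induction hn : f.natDegree using Nat.strong_induction_on generalizing f with
  | _ n ih =>
    rcases n with - | m
    · rw [eq_C_of_natDegree_eq_zero hn] at hf hf0
      exact ⟨_, fun h => hf0 (by rw [h, C_0]), hf⟩
    · have hmem : (show OreExtension δ from mulOp δ f (C b) - b • f) ∈ I := by
        have h := I.sub_mem (hr (inclusion δ b) _ hf) (hl (inclusion δ b) _ hf)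
        have h2 : mulOp δ (C b) f = b • f := by
          rw [← monomial_zero_left, mulOp_monomial, pow_zero, LinearMap.smul_apply,
            Module.End.one_apply]
        rw [← h2]
        exact h
      have hne : (mulOp δ f (C b) - b • f).coeff m ≠ 0 := by
        rw [coeff_commutator δ hn]
        refine mul_ne_zero (Nat.cast_ne_zero.2 m.succ_ne_zero) (mul_ne_zero ?_ hb)
        rw [← hn]
        exact leadingCoeff_ne_zero.2 hf0
      have hne' : mulOp δ f (C b) - b • f ≠ 0 := fun h => hne (by rw [h, coeff_zero])
      refine ih _ ?_ _ hmem hne' rfl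
      by_contra! h
      exact hne' (leadingCoeff_eq_zero.1 (coeff_commutator_of_lt δ hn b h))

/-! ### Proper one-sided ideals of `A[z; δ]` containing an ideal of `A` -/

/-- The constant term of an element of `A[z; δ]` written with its coefficients on the right. -/
def constTerm : A[X] →ₗ[ℂ] A :=
  Polynomial.lsum fun i => (-(δ : A →ₗ[ℂ] A)) ^ i

theorem constTerm_monomial (i : ℕ) (a : A) :
    constTerm δ (monomial i a) = ((-(δ : A →ₗ[ℂ] A)) ^ i) a := by
  simp [constTerm, Polynomial.lsum_apply, Polynomial.sum_monomial_index]

theorem constTerm_C (a : A) : constTerm δ (C a) = a :=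
  constTerm_monomial δ 0 a

/-- In `A[z; δ]` one has `a z = z a - δ(a)`, and left multiples by `z` have no constant term when
coefficients are on the right. -/
theorem constTerm_smul_mulZ (a : A) (f : A[X]) :
    constTerm δ (a • mulZ δ f) = constTerm δ ((-(δ : A →ₗ[ℂ] A)) a • f) := by
  induction f using Polynomial.induction_on' with
  | add p q hp hq => simp only [map_add, smul_add, hp, hq]
  | monomial n b =>
    rw [mulZ_monomial, smul_add, smul_monomial, smul_monomial, smul_monomial, map_add,
      constTerm_monomial, constTerm_monomial, constTerm_monomial, pow_succ, Module.End.mul_apply,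
      ← map_add]
    congr 1
    simp only [LinearMap.neg_apply, Derivation.coeFn_coe, smul_eq_mul, Derivation.leibniz]
    ring

theorem constTerm_smul_mulZ_pow (n : ℕ) (a : A) (f : A[X]) :
    constTerm δ (a • (mulZ δ ^ n) f) = constTerm δ (((-(δ : A →ₗ[ℂ] A)) ^ n) a • f) := by
  induction n generalizing a with
  | zero => simp
  | succ n ih =>
    rw [mulZ_pow_succ_apply, constTerm_smul_mulZ, ih, pow_succ, Module.End.mul_apply]

/-- Modulo the right ideal generated by `z`, `f` may be replaced by its constant term before
multiplying by `g`. -/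
theorem constTerm_mulOp (f g : A[X]) :
    constTerm δ (mulOp δ f g) = constTerm δ (constTerm δ f • g) := by
  induction f using Polynomial.induction_on' with
  | add p q hp hq => simp only [map_add, LinearMap.add_apply, add_smul, hp, hq]
  | monomial n a =>
    rw [mulOp_monomial, LinearMap.smul_apply, constTerm_smul_mulZ_pow, constTerm_monomial]

/-- A proper left ideal of `A[z; δ]` containing a given proper ideal of `A`. -/
def leftIdealOf (M : Ideal A) : Ideal (OreExtension δ) where
  carrier := {s | ∀ r : OreExtension δ, constTerm δ (r * s : OreExtension δ) ∈ M}
  add_mem' {s t} hs ht r := by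
    have h : constTerm δ (r * s + r * t : OreExtension δ) =
        constTerm δ (r * s : OreExtension δ) + constTerm δ (r * t : OreExtension δ) :=
      map_add (constTerm δ) _ _
    rw [mul_add, h]
    exact add_mem (hs r) (ht r)
  zero_mem' r := by
    rw [mul_zero]
    have h := zero_mem M
    rwa [← map_zero (constTerm δ)] at h
  smul_mem' t s hs r := by
    rw [smul_eq_mul, ← mul_assoc]
    exact hs _

theorem inclusion_mem_leftIdealOf {M : Ideal A} {a : A} (ha : a ∈ M) :
    inclusion δ a ∈ leftIdealOf δ M := by
  intro r
  change constTerm δ (mulOp δ (show A[X] from r) (C a)) ∈ M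
  rw [constTerm_mulOp, smul_C, constTerm_C]
  exact M.mul_mem_left _ ha

theorem leftIdealOf_ne_top {M : Ideal A} (hM : M ≠ ⊤) : leftIdealOf δ M ≠ ⊤ := by
  intro h
  have h1 : (1 : OreExtension δ) ∈ leftIdealOf δ M := h ▸ trivial
  have h2 := h1 1
  rw [mul_one] at h2
  exact hM ((Ideal.eq_top_iff_one M).2 ((constTerm_C δ (1 : A)) ▸ h2))

theorem coeff_mulOp_mem {M : Ideal A} {f : A[X]} (hf : ∀ i, f.coeff i ∈ M) (g : A[X]) (k : ℕ) :
    (mulOp δ f g).coeff k ∈ M := by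
  rw [mulOp_apply, Polynomial.sum, finsetSum_coeff]
  refine sum_mem fun i _ => ?_
  rw [coeff_smul]
  exact M.mul_mem_right _ (hf i)

/-- The right ideal of `A[z; δ]` generated by an ideal of `A`, as a left ideal of the opposite
ring. -/
def rightIdealOf (M : Ideal A) : Ideal (OreExtension δ)ᵐᵒᵖ where
  carrier := {s | ∀ i, (show A[X] from s.unop).coeff i ∈ M}
  add_mem' {s t} hs ht i := by
    have h := add_mem (hs i) (ht i)
    rwa [← coeff_add] at h
  zero_mem' i := by
    have h := zero_mem M
    rwa [← coeff_zero i] at h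
  smul_mem' t s hs i := coeff_mulOp_mem δ hs _ i

/-- The inclusion of `A` in the opposite ring of `A[z; δ]`. -/
def inclusionOp : A →+* (OreExtension δ)ᵐᵒᵖ :=
  (inclusion δ).toOpposite fun a b => by
    change inclusion δ a * inclusion δ b = inclusion δ b * inclusion δ a
    rw [← map_mul, mul_comm, map_mul]

theorem inclusionOp_apply (a : A) : inclusionOp δ a = MulOpposite.op (inclusion δ a) := rfl

theorem inclusionOp_mem_rightIdealOf {M : Ideal A} {a : A} (ha : a ∈ M) :
    inclusionOp δ a ∈ rightIdealOf δ M := by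
  intro i
  change (C a).coeff i ∈ M
  rw [coeff_C]
  split_ifs
  exacts [ha, zero_mem M]

theorem rightIdealOf_ne_top {M : Ideal A} (hM : M ≠ ⊤) : rightIdealOf δ M ≠ ⊤ := by
  intro h
  have h1 : (1 : (OreExtension δ)ᵐᵒᵖ) ∈ rightIdealOf δ M := h ▸ trivial
  have h2 : (1 : A[X]).coeff 0 ∈ M := h1 0
  rw [coeff_one_zero] at h2
  exact hM ((Ideal.eq_top_iff_one M).2 h2)

theorem op_z_mul_inclusionOp (a : A) :
    MulOpposite.op (mono δ 1 1) * inclusionOp δ a =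
      inclusionOp δ a * MulOpposite.op (mono δ 1 1) + inclusionOp δ ((-δ) a) := by
  rw [inclusionOp_apply, inclusionOp_apply, ← MulOpposite.op_mul, ← MulOpposite.op_mul,
    ← MulOpposite.op_add, z_mul_inclusion, Derivation.neg_apply, map_neg, add_neg_cancel_right]

/-! ### Left and right primitivity of `A[z; δ]` -/

variable {δ}

theorem isLeftPrimitiveRing_iff [Algebra.FiniteType ℂ A] (hδ : δ ≠ 0) :
    IsLeftPrimitiveRing (OreExtension δ) ↔ IsDerivationPrimitive δ := by
  refine ⟨isDerivationPrimitive_of_isLeftPrimitiveRing (inclusion δ) (inclusion_injective δ)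
    (z_mul_inclusion δ) (mem_subring δ), ?_⟩
  rintro ⟨M, hM, hcore⟩
  have : IsDomain A := hcore.isDomain
  refine isLeftPrimitiveRing_of_hasTrivialCore (inclusion δ) (z_mul_inclusion δ) hcore
    (leftIdealOf_ne_top δ hM.ne_top) (fun a => inclusion_mem_leftIdealOf δ) fun I _ hI0 => ?_
  exact exists_inclusion_mem hδ I.toAddSubgroup (fun r s => I.mul_mem_left r)
    (fun r s hs => I.mul_mem_right r hs) fun h => hI0 (Submodule.toAddSubgroup_injective h)

theorem isRightPrimitiveRing_iff [Algebra.FiniteType ℂ A] (hδ : δ ≠ 0) :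
    IsRightPrimitiveRing (OreExtension δ) ↔ IsDerivationPrimitive δ := by
  -- Reversing the product turns the commutator with `z` into `-δ`.
  rw [← isDerivationPrimitive_neg]
  refine ⟨isDerivationPrimitive_of_isLeftPrimitiveRing (inclusionOp δ)
    (MulOpposite.op_injective.comp (inclusion_injective δ)) (op_z_mul_inclusionOp δ)
    fun T hA hz s => mem_subring δ T.unop hA hz s.unop, ?_⟩
  rintro ⟨M, hM, hcore⟩
  have : IsDomain A := hcore.isDomain
  refine isLeftPrimitiveRing_of_hasTrivialCore (inclusionOp δ) (op_z_mul_inclusionOp δ) hcore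
    (rightIdealOf_ne_top δ hM.ne_top) (fun a => inclusionOp_mem_rightIdealOf δ) fun I _ hI0 => ?_
  refine exists_inclusion_mem hδ (I.toAddSubgroup.comap
    (MulOpposite.opAddEquiv : OreExtension δ ≃+ (OreExtension δ)ᵐᵒᵖ).toAddMonoidHom)
    (fun r s hs => I.mul_mem_right (MulOpposite.op r) hs)
    (fun r s hs => I.mul_mem_left (MulOpposite.op r) hs) fun h => hI0 ?_
  refine (Submodule.eq_bot_iff _).2 fun s hs => MulOpposite.unop_injective ?_
  exact (AddSubgroup.eq_bot_iff_forall _).1 h s.unop hs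

end OreExtension

end

theorem mainTheorem5 {A : Type u} [CommRing A] [Algebra ℂ A] [Algebra.FiniteType ℂ A]
    (δ : Derivation ℂ A A) (hδ : δ ≠ 0) :
    ((deltaBracket δ).IsPoissonPrimitive ↔ IsLeftPrimitiveRing (OreExtension δ)) ∧
    ((deltaBracket δ).IsPoissonPrimitive ↔ IsRightPrimitiveRing (OreExtension δ)) := by
  rw [isPoissonPrimitive_deltaBracket_iff hδ, OreExtension.isLeftPrimitiveRing_iff hδ,
    OreExtension.isRightPrimitiveRing_iff hδ]
  exact ⟨Iff.rfl, Iff.rfl⟩
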